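/- Let $d\in\{2,3\}$, let $\Omega\subset\mathbb{R}^d$ be a bounded, open, connected set, and let $f\in L^2(\Omega)$. Write $(\cdot,\cdot)$ and $\|\cdot\|_0$ for the inner product and norm of $L^2(\Omega)$ (and of $L^2(\Omega)^d$), $\|v\|_1=(\|v\|_0^2+\|\nabla v\|_0^2)^{1/2}$ for the norm of $H^1(\Omega)$, and $H^1_0(\Omega)$ for the closure of $C_c^\infty(\Omega)$ in $H^1(\Omega)$. For $w,v\in H^1_0(\Omega)$ put $$a_{nl}(w,v)=(\nabla w,\nabla v)+(w,v)+(w^3,v).$$ For a conforming simplicial triangulation $\mathcal T_\bullet$ of $\Omega$ (a finite, purely $d$-dimensional simplicial complex with underlying space $\overline\Omega$), let $$\mathbb V_\bullet=\{v\in H^1_0(\Omega): v|_T \text{ is affine for every } d\text{-simplex } T\in\mathcal T_\bullet\}.$$ For every $w\in H^1_0(\Omega)$ one has $w^3\in L^2(\Omega)$, so that $a_{nl}$ is well defined. The weak form of $-\Delta u+u+u^3=f$ in $\Omega$, $u=0$ on $\partial\Omega$, namely: find $u\in H^1_0(\Omega)$ with $$a_{nl}(u,v)=(f,v)\qquad\text{for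 all } v\in H^1_0(\Omega),$$ has a unique solution $u$. For every $\mathcal T_\bullet$, the discrete problem: find $u_\bullet\in\mathbb V_\bullet$ with $$a_{nl}(u_\bullet,v_\bullet)=(f,v_\bullet)\qquad\text{for all } v_\bullet\in\mathbb V_\bullet,$$ has a unique solution $u_\bullet$. These solutions satisfy $$\|u\|_1\le\|f\|_0,\qquad \|u_\bullet\|_1\le\|f\|_0.$$ Moreover, there is a constant $c_f>0$, which may depend on $f$ (and on the fixed $d$ and $\Omega$) but not on $\mathcal T_\bullet$, such that for every $\mathcal T_\bullet$ $$\|u-u_\bullet\|_1\le c_f\inf_{v_\bullet\in\mathbb V_\bullet}\|u-v_\bullet\|_1 .$$ -/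

import Mathlib

open MeasureTheory TopologicalSpace
open scoped Distributions ContDiff

namespace NonlinearFEM

noncomputable section

/-- Euclidean `d`-space. -/
abbrev Space (d : ℕ) : Type := EuclideanSpace ℝ (Fin d)

/-- Lebesgue measure on `Ω`. -/
abbrev leb {d : ℕ} (Ω : Opens (Space d)) : Measure (Space d) :=
  volume.restrict (Ω : Set (Space d))

/-- The scalar space `L²(Ω)`, with its norm `‖·‖₀`. -/
abbrev L2 {d : ℕ} (Ω : Opens (Space d)) : Type := Lp ℝ 2 (leb Ω)

/-- The vector valued space `L²(Ω)^d`. -/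
abbrev L2Vec {d : ℕ} (Ω : Opens (Space d)) : Type := Lp (Space d) 2 (leb Ω)

/-- The partial derivative `∂ᵢ φ`. -/
def partialDeriv {d : ℕ} (i : Fin d) (φ : Space d → ℝ) (x : Space d) : ℝ :=
  fderiv ℝ φ x (EuclideanSpace.single i 1)

/-- `G ∈ L²(Ω)^d` is the weak gradient of `v ∈ L²(Ω)`:
`∫_Ω v ∂ᵢφ = - ∫_Ω Gᵢ φ` for all test functions `φ ∈ C_c^∞(Ω)` and all `i`. -/
def IsWeakGradient {d : ℕ} {Ω : Opens (Space d)} (v : L2 Ω) (G : L2Vec Ω) : Prop :=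
  ∀ (φ : 𝓓(Ω, ℝ)) (i : Fin d),
    ∫ x, v x * partialDeriv i φ x ∂(leb Ω) = - ∫ x, G x i * φ x ∂(leb Ω)

theorem memLp_test {d : ℕ} {Ω : Opens (Space d)} (φ : 𝓓(Ω, ℝ)) : MemLp φ 2 (leb Ω) :=
  (φ.contDiff.continuous.memLp_of_hasCompactSupport φ.hasCompactSupport)

theorem memLp_partialDeriv {d : ℕ} {Ω : Opens (Space d)} (φ : 𝓓(Ω, ℝ)) (i : Fin d) :
    MemLp (partialDeriv i φ) 2 (leb Ω) := by
  have h1 : Continuous (partialDeriv i φ) :=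
    (φ.contDiff.continuous_fderiv (by simp)).clm_apply continuous_const
  have h2 : HasCompactSupport (partialDeriv i φ) :=
    φ.hasCompactSupport.fderiv_apply ℝ _
  exact h1.memLp_of_hasCompactSupport h2

theorem integrable_mul_partialDeriv {d : ℕ} {Ω : Opens (Space d)} (v : L2 Ω) (φ : 𝓓(Ω, ℝ))
    (i : Fin d) : Integrable (fun x => v x * partialDeriv i φ x) (leb Ω) :=
  MemLp.integrable_mul (Lp.memLp v) (memLp_partialDeriv φ i)

theorem integrable_coord_mul {d : ℕ} {Ω : Opens (Space d)} (G : L2Vec Ω) (φ : 𝓓(Ω, ℝ))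
    (i : Fin d) : Integrable (fun x => G x i * φ x) (leb Ω) := by
  have h : MemLp (fun x => G x i) 2 (leb Ω) :=
    (EuclideanSpace.proj (𝕜 := ℝ) i).comp_memLp' (Lp.memLp G)
  exact MemLp.integrable_mul h (memLp_test φ)

/-- The Sobolev space `H¹(Ω)`, realized as the graph of the weak gradient: the pairs `(v, ∇v)` with
`v ∈ L²(Ω)` and weak gradient `∇v ∈ L²(Ω)^d` (which `v` determines). The inherited norm is
the `H¹` norm `‖v‖₁ = (‖v‖₀² + ‖∇v‖₀²)^{1/2}`. -/
def H1 {d : ℕ} (Ω : Opens (Space d)) : Submodule ℝ (WithLp 2 (L2 Ω × L2Vec Ω)) where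
  carrier := {p | IsWeakGradient p.fst p.snd}
  zero_mem' := by
    intro φ i
    have h1 : ∫ x, (0 : L2 Ω) x * partialDeriv i φ x ∂(leb Ω) = 0 := by
      refine integral_eq_zero_of_ae ?_
      filter_upwards [Lp.coeFn_zero ℝ 2 (leb Ω)] with x hx
      rw [hx]
      exact zero_mul _
    have h2 : ∫ x, (0 : L2Vec Ω) x i * φ x ∂(leb Ω) = 0 := by
      refine integral_eq_zero_of_ae ?_
      filter_upwards [Lp.coeFn_zero (Space d) 2 (leb Ω)] with x hx
      rw [hx]
      exact zero_mul _
    simp only [WithLp.zero_fst, WithLp.zero_snd]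
    rw [h1, h2, neg_zero]
  add_mem' := by
    intro p q hp hq φ i
    have h1 : ∫ x, (p.fst + q.fst) x * partialDeriv i φ x ∂(leb Ω)
        = ∫ x, p.fst x * partialDeriv i φ x ∂(leb Ω)
          + ∫ x, q.fst x * partialDeriv i φ x ∂(leb Ω) := by
      rw [← integral_add (integrable_mul_partialDeriv _ φ i) (integrable_mul_partialDeriv _ φ i)]
      refine integral_congr_ae ?_
      filter_upwards [Lp.coeFn_add p.fst q.fst] with x hx
      rw [hx, Pi.add_apply, add_mul]
    have h2 : ∫ x, (p.snd + q.snd) x i * φ x ∂(leb Ω)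
        = ∫ x, p.snd x i * φ x ∂(leb Ω) + ∫ x, q.snd x i * φ x ∂(leb Ω) := by
      rw [← integral_add (integrable_coord_mul _ φ i) (integrable_coord_mul _ φ i)]
      refine integral_congr_ae ?_
      filter_upwards [Lp.coeFn_add p.snd q.snd] with x hx
      rw [hx, Pi.add_apply, PiLp.add_apply, add_mul]
    simp only [WithLp.add_fst, WithLp.add_snd]
    rw [h1, h2, hp φ i, hq φ i, neg_add]
  smul_mem' := by
    intro c p hp φ i
    have h1 : ∫ x, (c • p.fst) x * partialDeriv i φ x ∂(leb Ω)
        = c * ∫ x, p.fst x * partialDeriv i φ x ∂(leb Ω) := by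
      rw [← integral_const_mul]
      refine integral_congr_ae ?_
      filter_upwards [Lp.coeFn_smul c p.fst] with x hx
      rw [hx, Pi.smul_apply, smul_eq_mul, mul_assoc]
    have h2 : ∫ x, (c • p.snd) x i * φ x ∂(leb Ω) = c * ∫ x, p.snd x i * φ x ∂(leb Ω) := by
      rw [← integral_const_mul]
      refine integral_congr_ae ?_
      filter_upwards [Lp.coeFn_smul c p.snd] with x hx
      rw [hx, Pi.smul_apply, PiLp.smul_apply, smul_eq_mul, mul_assoc]
    simp only [WithLp.smul_fst, WithLp.smul_snd]
    rw [h1, h2, hp φ i, mul_neg]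

/-- The elements of `H¹(Ω)` that are (almost everywhere) equal to a function in `C_c^∞(Ω)`. -/
def testSubspace {d : ℕ} (Ω : Opens (Space d)) : Submodule ℝ (H1 Ω) where
  carrier := {u | ∃ φ : 𝓓(Ω, ℝ), u.1.fst =ᵐ[leb Ω] φ}
  zero_mem' := ⟨0, Lp.coeFn_zero ℝ 2 (leb Ω)⟩
  add_mem' := by
    rintro u v ⟨φ, hφ⟩ ⟨ψ, hψ⟩
    exact ⟨φ + ψ, (Lp.coeFn_add u.1.fst v.1.fst).trans (hφ.add hψ)⟩
  smul_mem' := by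
    rintro c u ⟨φ, hφ⟩
    exact ⟨c • φ, (Lp.coeFn_smul c u.1.fst).trans (hφ.const_smul c)⟩

/-- The space `H¹₀(Ω)`: the closure of `C_c^∞(Ω)` in `H¹(Ω)`. -/
def H10 {d : ℕ} (Ω : Opens (Space d)) : Submodule ℝ (H1 Ω) :=
  (testSubspace Ω).topologicalClosure

/-- The function underlying an element of `H¹₀(Ω)`. -/
def fn {d : ℕ} {Ω : Opens (Space d)} (u : H10 Ω) : L2 Ω := u.1.1.fst

/-- The weak gradient of an element of `H¹₀(Ω)`. -/
def grad {d : ℕ} {Ω : Opens (Space d)} (u : H10 Ω) : L2Vec Ω := u.1.1.snd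

/-- The norm of `H¹₀(Ω)` is the `H¹` norm. -/
theorem norm_sq_eq {d : ℕ} {Ω : Opens (Space d)} (u : H10 Ω) :
    ‖u‖ ^ 2 = ‖fn u‖ ^ 2 + ‖grad u‖ ^ 2 :=
  WithLp.prod_norm_sq_eq_of_L2 u.1.1

/-- A conforming simplicial triangulation of `Ω`: a finite simplicial complex (simplices meet in
common faces) that is pure of dimension `d` and whose underlying space is the closure of `Ω`. -/
structure Triangulation {d : ℕ} (Ω : Opens (Space d)) where
  complex : Geometry.SimplicialComplex ℝ (Space d)
  finite : complex.faces.Finite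
  pure : ∀ s ∈ complex.faces, ∃ t ∈ complex.faces, s ⊆ t ∧ t.card = d + 1
  covers : complex.space = closure (Ω : Set (Space d))

/-- `T` is an element of the triangulation: a closed `d`-simplex of the complex. -/
def Triangulation.IsElement {d : ℕ} {Ω : Opens (Space d)} (𝒯 : Triangulation Ω)
    (T : Set (Space d)) : Prop :=
  ∃ s ∈ 𝒯.complex.faces, s.card = d + 1 ∧ T = convexHull ℝ (s : Set (Space d))

/-- The linear `C⁰`-conforming finite element space
`{v ∈ H¹₀(Ω) : v|_T ∈ P₁(T) for all elements T}`. -/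
def Triangulation.feSpace {d : ℕ} {Ω : Opens (Space d)} (𝒯 : Triangulation Ω) :
    Submodule ℝ (H10 Ω) where
  carrier := {v | ∀ T, 𝒯.IsElement T → ∃ p : Space d →ᵃ[ℝ] ℝ, ∀ᵐ x ∂(leb Ω), x ∈ T → fn v x = p x}
  zero_mem' := by
    intro T _
    refine ⟨0, ?_⟩
    filter_upwards [Lp.coeFn_zero ℝ 2 (leb Ω)] with x hx _
    exact hx
  add_mem' := by
    intro u v hu hv T hT
    obtain ⟨p, hp⟩ := hu T hT
    obtain ⟨q, hq⟩ := hv T hT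
    refine ⟨p + q, ?_⟩
    filter_upwards [hp, hq, Lp.coeFn_add (fn u) (fn v)] with x h1 h2 h3 hx
    have h4 : fn (u + v) x = fn u x + fn v x := h3
    rw [h4, h1 hx, h2 hx]
    rfl
  smul_mem' := by
    intro c u hu T hT
    obtain ⟨p, hp⟩ := hu T hT
    refine ⟨c • p, ?_⟩
    filter_upwards [hp, Lp.coeFn_smul c (fn u)] with x h1 h3 hx
    have h4 : fn (c • u) x = c * fn u x := h3
    rw [h4, h1 hx]
    rfl

/-- The form `a_nl(w, v) = (∇w, ∇v) + (w, v) + (w³, v)`. -/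
def aNl {d : ℕ} {Ω : Opens (Space d)} (w v : H10 Ω) : ℝ :=
  (∫ x, inner ℝ (grad w x) (grad v x) ∂(leb Ω)) + (∫ x, fn w x * fn v x ∂(leb Ω))
    + ∫ x, fn w x ^ 3 * fn v x ∂(leb Ω)

/-- The right-hand side `(f, v)`. -/
def load {d : ℕ} {Ω : Opens (Space d)} (f : L2 Ω) (v : H10 Ω) : ℝ :=
  ∫ x, f x * fn v x ∂(leb Ω)

/-- `u ∈ H¹₀(Ω)` solves the weak problem for `-Δu + u + u³ = f`, `u = 0` on `∂Ω`. -/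
def IsWeakSolution {d : ℕ} {Ω : Opens (Space d)} (f : L2 Ω) (u : H10 Ω) : Prop :=
  ∀ v : H10 Ω, aNl u v = load f v

/-- `uh` in the finite element space of `𝒯` solves the discrete problem. -/
def IsDiscreteSolution {d : ℕ} {Ω : Opens (Space d)} (f : L2 Ω) (𝒯 : Triangulation Ω)
    (uh : 𝒯.feSpace) : Prop :=
  ∀ vh : 𝒯.feSpace, aNl (uh : H10 Ω) vh = load f vh

end

end NonlinearFEM

/-! The equation is the Euler-Lagrange equation of the energy `‖u‖²/2 + ∫ u⁴/4 - (f, u)`. The linear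
part of `aNl` is exactly the H¹ inner product and the quartic term is convex, so the energy lies
above each of its tangents by at least half the squared H¹ distance (`energy_strongly_convex`). On
every closed subspace this gives existence by minimization. Adding two such inequalities shows that
the derivative is strongly monotone with constant one, which gives uniqueness and, by comparison
with zero, the bound by `‖f‖`.

The dimension enters through the embedding of H¹₀ into L⁶ (`exists_eLpNorm_six_le`): it puts `w³` in
L² and makes `w ↦ w³` Lipschitz on balls. By stability, `u` and every discrete solution lie in the
ball of radius `‖f‖`, whatever the mesh. Strong monotonicity, Galerkin orthogonality and the
Lipschitz bound on that ball then yield Céa's estimate. -/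

namespace NonlinearFEM

open Filter Topology
open scoped ENNReal NNReal

/-! ### Strongly convex functionals and Galerkin solutions in a normed space -/

section Abstract

variable {E : Type*} [NormedAddCommGroup E] [NormedSpace ℝ E]

theorem bddBelow_range_of_stronglyConvex {J : E → ℝ} {A : E → E →L[ℝ] ℝ}
    (h : ∀ u v, J u + A u (v - u) + ‖v - u‖ ^ 2 / 2 ≤ J v) : BddBelow (Set.range J) := by
  refine ⟨J 0 - ‖A 0‖ ^ 2 / 2, ?_⟩
  rintro _ ⟨v, rfl⟩
  have h1 := h 0 v
  have h2 := neg_le_of_abs_le ((A 0).le_opNorm v)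
  rw [sub_zero] at h1
  nlinarith [sq_nonneg (‖A 0‖ - ‖v‖)]

/-- Sum the convexity inequalities based at the midpoint of `a` and `b`: the linear terms cancel.
This forces minimizing sequences to be Cauchy. -/
theorem norm_sub_sq_le_of_stronglyConvex {J : E → ℝ} {A : E → E →L[ℝ] ℝ}
    (h : ∀ u v, J u + A u (v - u) + ‖v - u‖ ^ 2 / 2 ≤ J v) (a b : E) :
    ‖a - b‖ ^ 2 / 4 ≤ J a + J b - 2 * ⨅ v, J v := by
  set m : E := (1 / 2 : ℝ) • (a + b)
  have ha : a - m = (1 / 2 : ℝ) • (a - b) := by simp only [m]; module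
  have hb : b - m = -((1 / 2 : ℝ) • (a - b)) := by simp only [m]; module
  have h1 := h m a
  have h2 := h m b
  have h3 : ⨅ v, J v ≤ J m := ciInf_le (bddBelow_range_of_stronglyConvex h) m
  have h4 : ‖(1 / 2 : ℝ) • (a - b)‖ = ‖a - b‖ / 2 := by
    rw [norm_smul]; norm_num; ring
  rw [ha, h4] at h1
  rw [hb, norm_neg, h4, map_neg] at h2
  linarith

/-- A Gateaux differentiable, strongly convex functional on a Banach space attains its minimum. -/
theorem exists_isMinOn_of_stronglyConvex [CompleteSpace E] {J : E → ℝ} {A : E → E →L[ℝ] ℝ}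
    (h : ∀ u v, J u + A u (v - u) + ‖v - u‖ ^ 2 / 2 ≤ J v) : ∃ u, ∀ v, J u ≤ J v := by
  have hbdd := bddBelow_range_of_stronglyConvex h
  have hex : ∀ n : ℕ, ∃ u, J u < (⨅ v, J v) + 1 / ((n : ℝ) + 1) := fun n =>
    exists_lt_of_ciInf_lt (lt_add_of_pos_right _ Nat.one_div_pos_of_nat)
  choose u hu using hex
  have hε : Tendsto (fun n : ℕ => 1 / ((n : ℝ) + 1)) atTop (𝓝 0) :=
    tendsto_one_div_add_atTop_nhds_zero_nat
  have hcauchy : CauchySeq u := by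
    refine cauchySeq_of_le_tendsto_0 (fun n : ℕ => √(8 * (1 / ((n : ℝ) + 1)))) ?_ ?_
    · intro k l N hk hl
      rw [dist_eq_norm]
      refine Real.le_sqrt_of_sq_le ?_
      have h1 := norm_sub_sq_le_of_stronglyConvex h (u k) (u l)
      have h2 : 1 / ((k : ℝ) + 1) ≤ 1 / ((N : ℝ) + 1) := Nat.one_div_le_one_div hk
      have h3 : 1 / ((l : ℝ) + 1) ≤ 1 / ((N : ℝ) + 1) := Nat.one_div_le_one_div hl
      linarith [hu k, hu l]
    · simpa using (hε.const_mul 8).sqrt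
  obtain ⟨w, hw⟩ := cauchySeq_tendsto_of_complete hcauchy
  refine ⟨w, fun v => le_trans ?_ (ciInf_le hbdd v)⟩
  -- `J` is not assumed continuous: its tangent at `w` is a continuous lower bound, which is all the
  -- limit needs.
  have hl : Tendsto (fun n => J w + A w (u n - w)) atTop (𝓝 (J w)) := by
    have h1 := ((A w).continuous.tendsto _).comp (hw.sub_const w)
    simpa using h1.const_add (J w)
  have hr : Tendsto (fun n : ℕ => (⨅ v, J v) + 1 / ((n : ℝ) + 1)) atTop (𝓝 (⨅ v, J v)) := by
    simpa using hε.const_add (⨅ v, J v)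
  refine le_of_tendsto_of_tendsto' hl hr fun n => ?_
  have h1 := h w (u n)
  have h2 := sq_nonneg ‖u n - w‖
  linarith [hu n]

/-- The minimizer is a zero of `A`. Differentiability of `J` is not needed, only continuity of `A`
in its base point. -/
theorem exists_zero_of_stronglyConvex [CompleteSpace E] {J : E → ℝ} {A : E → E →L[ℝ] ℝ}
    (hA : ∀ v, Continuous fun u => A u v) (h : ∀ u v, J u + A u (v - u) + ‖v - u‖ ^ 2 / 2 ≤ J v) :
    ∃ u, A u = 0 := by
  obtain ⟨u, hu⟩ := exists_isMinOn_of_stronglyConvex h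
  have hnonneg : ∀ v, 0 ≤ A u v := by
    intro v
    have hlim : Tendsto (fun n : ℕ => A (u + (1 / ((n : ℝ) + 1)) • v) v) atTop (𝓝 (A u v)) := by
      have h1 : Continuous fun t : ℝ => A (u + t • v) v :=
        (hA v).comp (by fun_prop : Continuous fun t : ℝ => u + t • v)
      simpa [Function.comp_def] using
        (h1.tendsto 0).comp (tendsto_one_div_add_atTop_nhds_zero_nat (𝕜 := ℝ))
    refine ge_of_tendsto' hlim fun n => ?_
    have ht : 0 < 1 / ((n : ℝ) + 1) := Nat.one_div_pos_of_nat
    set t := 1 / ((n : ℝ) + 1)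
    -- The tangent is taken at the displaced point: with minimality of `u` it gives `t * A (u + t •
    -- v) v ≥ 0`; divide by `t` and let `t → 0`.
    have h1 := h (u + t • v) u
    have h2 := hu (u + t • v)
    have h3 : u - (u + t • v) = -(t • v) := by abel
    rw [h3, map_neg, map_smul, smul_eq_mul] at h1
    have h4 := sq_nonneg ‖-(t • v)‖
    exact nonneg_of_mul_nonneg_right (by linarith) ht
  refine ⟨u, ContinuousLinearMap.ext fun v => le_antisymm ?_ (hnonneg v)⟩
  have h1 := hnonneg (-v)
  rw [map_neg] at h1
  simpa using h1

/-- Strong monotonicity, from adding the convexity inequalities at `u` and at `v`. -/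
theorem norm_sub_sq_le_of_gradient_inequality {J : E → ℝ} {A : E → E →L[ℝ] ℝ}
    (h : ∀ u v, J u + A u (v - u) + ‖v - u‖ ^ 2 / 2 ≤ J v) (u v : E) :
    ‖u - v‖ ^ 2 ≤ A u (u - v) - A v (u - v) := by
  have h1 := h u v
  have h2 := h v u
  rw [← neg_sub u v, map_neg, norm_neg] at h1
  linarith

/-- `u ∈ V` solves the equation `A u = 0` tested with the subspace `V`. -/
def IsGalerkinSolution (A : E → E →L[ℝ] ℝ) (V : Submodule ℝ E) (u : E) : Prop :=
  u ∈ V ∧ ∀ v ∈ V, A u v = 0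

/-- The hypotheses on `J` and `A` pass to the subspace, which is complete because it is closed. -/
theorem exists_isGalerkinSolution [CompleteSpace E] {J : E → ℝ} {A : E → E →L[ℝ] ℝ}
    (hA : ∀ v, Continuous fun u => A u v) (h : ∀ u v, J u + A u (v - u) + ‖v - u‖ ^ 2 / 2 ≤ J v)
    {V : Submodule ℝ E} (hV : IsClosed (V : Set E)) : ∃ u, IsGalerkinSolution A V u := by
  have : CompleteSpace V := hV.completeSpace_coe
  obtain ⟨u, hu⟩ := exists_zero_of_stronglyConvex (E := V) (J := fun u => J u)
    (A := fun u => (A u).comp V.subtypeL)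
    (fun v => (hA v).comp continuous_subtype_val) (fun u v => h u v)
  exact ⟨u, u.2, fun v hv => DFunLike.congr_fun hu ⟨v, hv⟩⟩

theorem IsGalerkinSolution.unique {J : E → ℝ} {A : E → E →L[ℝ] ℝ}
    (h : ∀ u v, J u + A u (v - u) + ‖v - u‖ ^ 2 / 2 ≤ J v) {V : Submodule ℝ E} {u v : E}
    (hu : IsGalerkinSolution A V u) (hv : IsGalerkinSolution A V v) : u = v := by
  have h1 := norm_sub_sq_le_of_gradient_inequality h u v
  have hmem := V.sub_mem hu.1 hv.1
  rw [hu.2 _ hmem, hv.2 _ hmem, sub_self] at h1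
  exact sub_eq_zero.1 (norm_eq_zero.1 (pow_eq_zero_iff two_ne_zero |>.1
    (le_antisymm h1 (sq_nonneg _))))

/-- Stability: testing with the solution itself. -/
theorem IsGalerkinSolution.norm_le {J : E → ℝ} {A : E → E →L[ℝ] ℝ}
    (h : ∀ u v, J u + A u (v - u) + ‖v - u‖ ^ 2 / 2 ≤ J v) {R : ℝ} (hR : 0 ≤ R)
    (h0 : ∀ v, |A 0 v| ≤ R * ‖v‖) {V : Submodule ℝ E} {u : E}
    (hu : IsGalerkinSolution A V u) : ‖u‖ ≤ R := by
  have h1 := norm_sub_sq_le_of_gradient_inequality h u 0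
  rw [sub_zero, hu.2 u hu.1] at h1
  have h2 := neg_le_of_abs_le (h0 u)
  nlinarith [norm_nonneg u]

/-- Céa's lemma: Galerkin solutions are quasi-optimal if `A` is Lipschitz on a ball that contains
them. -/
theorem IsGalerkinSolution.norm_sub_le {J : E → ℝ} {A : E → E →L[ℝ] ℝ}
    (h : ∀ u v, J u + A u (v - u) + ‖v - u‖ ^ 2 / 2 ≤ J v) {R L : ℝ} (hL : 0 ≤ L)
    (hlip : ∀ u v w, ‖u‖ ≤ R → ‖v‖ ≤ R → |A u w - A v w| ≤ L * ‖u - v‖ * ‖w‖)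
    {V : Submodule ℝ E} {u uh v : E} (hu : IsGalerkinSolution A ⊤ u)
    (huh : IsGalerkinSolution A V uh) (huR : ‖u‖ ≤ R) (huhR : ‖uh‖ ≤ R) (hv : v ∈ V) :
    ‖u - uh‖ ≤ L * ‖u - v‖ := by
  have h1 := norm_sub_sq_le_of_gradient_inequality h u uh
  -- Galerkin orthogonality: `A u` vanishes everywhere and `A uh` vanishes on `v - uh ∈ V`, so `uh`
  -- may be replaced by `v` in the test argument.
  have horth : A u (u - uh) - A uh (u - uh) = A u (u - v) - A uh (u - v) := by
    have h2 : u - uh = (u - v) + (v - uh) := by abel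
    rw [hu.2 _ Submodule.mem_top, hu.2 _ Submodule.mem_top, h2, map_add,
      huh.2 _ (V.sub_mem hv huh.1), add_zero]
  have h3 := (le_abs_self _).trans (hlip u uh (u - v) huR huhR)
  rcases (norm_nonneg (u - uh)).eq_or_lt with h0 | h0
  · rw [← h0]; positivity
  · refine le_of_mul_le_mul_left ?_ h0
    linarith

end Abstract

/-! ### Completeness of H¹ and H¹₀ -/

variable {d : ℕ} {Ω : Opens (Space d)}

/-- The field `g eᵢ` represents `G ↦ ∫ Gᵢ g` as an inner product on L²(Ω)^d, so the identities
defining a weak gradient are closed conditions. -/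
theorem memLp_smul_single {g : Space d → ℝ} (hg : MemLp g 2 (leb Ω)) (i : Fin d) :
    MemLp (fun x => g x • (EuclideanSpace.single i 1 : Space d)) 2 (leb Ω) := by
  refine (hg.norm.of_le (hg.1.smul_const _) (Eventually.of_forall fun x => ?_))
  simp [norm_smul]

theorem integral_mul_eq_inner (v : L2 Ω) {g : Space d → ℝ} (hg : MemLp g 2 (leb Ω)) :
    ∫ x, v x * g x ∂(leb Ω) = inner ℝ (hg.toLp g) v := by
  rw [L2.inner_def]
  refine integral_congr_ae ?_
  filter_upwards [hg.coeFn_toLp] with x hx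
  simp [hx]

theorem integral_coord_mul_eq_inner (G : L2Vec Ω) {g : Space d → ℝ} (hg : MemLp g 2 (leb Ω))
    (i : Fin d) :
    ∫ x, G x i * g x ∂(leb Ω) = inner ℝ ((memLp_smul_single hg i).toLp _) G := by
  rw [L2.inner_def]
  refine integral_congr_ae ?_
  filter_upwards [(memLp_smul_single hg i).coeFn_toLp] with x hx
  rw [hx, real_inner_smul_left, EuclideanSpace.inner_single_left]
  simp [mul_comm]

theorem isClosed_H1 (Ω : Opens (Space d)) :
    IsClosed (H1 Ω : Set (WithLp 2 (L2 Ω × L2Vec Ω))) := by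
  have h : (H1 Ω : Set (WithLp 2 (L2 Ω × L2Vec Ω))) =
      ⋂ (φ : 𝓓(Ω, ℝ)) (i : Fin d),
        {p | inner ℝ ((memLp_partialDeriv φ i).toLp _) p.fst =
          -inner ℝ ((memLp_smul_single (memLp_test φ) i).toLp _) p.snd} := by
    ext p
    simp only [Set.mem_iInter, Set.mem_ofPred_eq]
    refine forall_congr' fun φ => forall_congr' fun i => ?_
    rw [integral_mul_eq_inner p.fst (memLp_partialDeriv φ i),
      integral_coord_mul_eq_inner p.snd (memLp_test φ) i]
  rw [h]
  refine isClosed_iInter fun φ => isClosed_iInter fun i => ?_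
  have h1 : Continuous fun p : WithLp 2 (L2 Ω × L2Vec Ω) => p.fst :=
    continuous_fst.comp (WithLp.prod_continuous_ofLp 2 _ _)
  have h2 : Continuous fun p : WithLp 2 (L2 Ω × L2Vec Ω) => p.snd :=
    continuous_snd.comp (WithLp.prod_continuous_ofLp 2 _ _)
  exact isClosed_eq (continuous_const.inner h1) (continuous_const.inner h2).neg

instance : CompleteSpace (H1 Ω) := (isClosed_H1 Ω).completeSpace_coe

instance : CompleteSpace (H10 Ω) :=
  (Submodule.isClosed_topologicalClosure (testSubspace Ω)).completeSpace_coe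

/-! ### Weak gradients of test functions -/

/-- Integration by parts against a test function. -/
theorem integral_test_mul_partialDeriv (φ ψ : 𝓓(Ω, ℝ)) (i : Fin d) :
    ∫ x, φ x * partialDeriv i ψ x ∂(leb Ω) = -∫ x, partialDeriv i φ x * ψ x ∂(leb Ω) := by
  have hφ : Differentiable ℝ φ := φ.contDiff.differentiable (by simp)
  have hψ : Differentiable ℝ ψ := ψ.contDiff.differentiable (by simp)
  have cφ : Continuous (partialDeriv i φ) :=
    (φ.contDiff.continuous_fderiv (by simp)).clm_apply continuous_const
  have cψ : Continuous (partialDeriv i ψ) :=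
    (ψ.contDiff.continuous_fderiv (by simp)).clm_apply continuous_const
  have hsφ : ∀ x, x ∉ (Ω : Set (Space d)) → φ x = 0 := fun x hx =>
    image_eq_zero_of_notMem_tsupport fun h => hx (φ.tsupport_subset h)
  have hsψ : ∀ x, x ∉ (Ω : Set (Space d)) → ψ x = 0 := fun x hx =>
    image_eq_zero_of_notMem_tsupport fun h => hx (ψ.tsupport_subset h)
  -- Both factors vanish off `Ω`, so the integrals extend to the whole space, where no boundary term
  -- arises.
  rw [setIntegral_eq_integral_of_forall_compl_eq_zero fun x hx => by rw [hsφ x hx, zero_mul],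
    setIntegral_eq_integral_of_forall_compl_eq_zero fun x hx => by rw [hsψ x hx, mul_zero]]
  refine integral_mul_fderiv_eq_neg_fderiv_mul_of_integrable ?_ ?_ ?_
    (fun x _ => hφ x) (fun x _ => hψ x)
  · exact (cφ.mul ψ.continuous).integrable_of_hasCompactSupport ψ.hasCompactSupport.mul_left
  · exact (φ.continuous.mul cψ).integrable_of_hasCompactSupport φ.hasCompactSupport.mul_right
  · exact (φ.continuous.mul ψ.continuous).integrable_of_hasCompactSupport
      φ.hasCompactSupport.mul_right

/-- The weak gradient of a test function is its classical gradient. -/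
theorem IsWeakGradient.coord_ae_eq {v : L2 Ω} {G : L2Vec Ω} (h : IsWeakGradient v G)
    {φ : 𝓓(Ω, ℝ)} (hv : v =ᵐ[leb Ω] φ) (i : Fin d) :
    ∀ᵐ x ∂(leb Ω), G x i = partialDeriv i φ x := by
  have hG : MemLp (fun x => G x i) 2 (leb Ω) :=
    (EuclideanSpace.proj (𝕜 := ℝ) i).comp_memLp' (Lp.memLp G)
  have hD := memLp_partialDeriv φ i
  have hloc : LocallyIntegrableOn (fun x => G x i - partialDeriv i φ x) (Ω : Set (Space d))
      volume :=
    locallyIntegrableOn_of_locallyIntegrable_restrict ((hG.sub hD).locallyIntegrable (by simp))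
  rw [ae_restrict_iff' Ω.isOpen.measurableSet]
  -- Fundamental lemma of the calculus of variations, applied to the difference of weak and
  -- classical derivatives.
  refine (Ω.isOpen.ae_eq_zero_of_integral_contDiff_smul_eq_zero hloc ?_).mono
    fun x hx hxΩ => sub_eq_zero.1 (hx hxΩ)
  intro g hg hgc hgs
  let ψ : 𝓓(Ω, ℝ) := ⟨g, hg, hgc, hgs⟩
  have hψ : ∀ x, ψ x = g x := fun _ => rfl
  have h1 := h ψ i
  have h2 := integral_test_mul_partialDeriv φ ψ i
  have h3 : ∫ x, v x * partialDeriv i ψ x ∂(leb Ω) = ∫ x, φ x * partialDeriv i ψ x ∂(leb Ω) :=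
    integral_congr_ae (by filter_upwards [hv] with x hx; rw [hx])
  rw [h3, h2, neg_inj] at h1
  have hi1 : Integrable (fun x => G x i * ψ x) (leb Ω) := integrable_coord_mul G ψ i
  have hi2 : Integrable (fun x => partialDeriv i φ x * ψ x) (leb Ω) :=
    hD.integrable_mul (memLp_test ψ)
  rw [← setIntegral_eq_integral_of_forall_compl_eq_zero (s := (Ω : Set (Space d)))]
  · have : ∀ x, g x • (G x i - partialDeriv i φ x) = G x i * ψ x - partialDeriv i φ x * ψ x := by
      intro x; rw [hψ, smul_eq_mul]; ring
    simp_rw [this]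
    rw [integral_sub hi1 hi2, h1, sub_self]
  · intro x hx
    rw [image_eq_zero_of_notMem_tsupport fun h => hx (hgs h), zero_smul]

/-- The Riesz isometry matches the operator norm used in the Sobolev inequality with the Euclidean
norm used in H¹. -/
theorem norm_fderiv_eq (φ : Space d → ℝ) (x : Space d) :
    ‖fderiv ℝ φ x‖ = ‖(WithLp.toLp 2 fun i => partialDeriv i φ x : Space d)‖ := by
  rw [← (InnerProductSpace.toDual ℝ (Space d)).symm.norm_map]
  congr 1
  ext i
  have h := InnerProductSpace.toDual_symm_apply (𝕜 := ℝ) (x := EuclideanSpace.single i (1 : ℝ))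
    (y := fderiv ℝ φ x)
  rw [EuclideanSpace.inner_single_right] at h
  simpa [partialDeriv] using h

theorem IsWeakGradient.norm_ae_eq {v : L2 Ω} {G : L2Vec Ω} (h : IsWeakGradient v G)
    {φ : 𝓓(Ω, ℝ)} (hv : v =ᵐ[leb Ω] φ) : ∀ᵐ x ∂(leb Ω), ‖fderiv ℝ φ x‖ = ‖G x‖ := by
  filter_upwards [ae_all_iff.2 fun i => h.coord_ae_eq hv i] with x hx
  rw [norm_fderiv_eq]
  congr 1
  ext i
  exact (hx i).symm

/-! ### The Sobolev embedding into L⁶ -/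

/-- An exponent whose Sobolev conjugate is at least six. -/
theorem exists_sobolev_exponent (hd : d = 2 ∨ d = 3) :
    ∃ p : ℝ≥0, 1 ≤ p ∧ p < Module.finrank ℝ (Space d) ∧
      (p : ℝ)⁻¹ - (Module.finrank ℝ (Space d) : ℝ)⁻¹ ≤ ((6 : ℝ≥0) : ℝ)⁻¹ ∧ p ≤ 2 := by
  rw [finrank_euclideanSpace_fin]
  rcases hd with rfl | rfl
  -- The inequality needs `p < d`, which excludes `p = 2` in the plane; `3/2` has conjugate exponent
  -- exactly 6, as does `2` in dimension three.
  · refine ⟨3 / 2, ?_, ?_, ?_, ?_⟩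
    · rw [← NNReal.coe_le_coe]; norm_num
    · rw [← NNReal.coe_lt_coe]; norm_num
    · norm_num
    · rw [← NNReal.coe_le_coe]; norm_num
  · exact ⟨2, by norm_num, by norm_num, by norm_num, le_rfl⟩

theorem exists_eLpNorm_le_eLpNorm_two {α F : Type*} [MeasurableSpace α] [NormedAddCommGroup F]
    (μ : Measure α) [IsFiniteMeasure μ] {p : ℝ≥0} (hp1 : 1 ≤ p) (hp2 : p ≤ 2) :
    ∃ M : ℝ≥0, ∀ g : α → F, AEStronglyMeasurable g μ → eLpNorm g p μ ≤ M * eLpNorm g 2 μ := by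
  set M : ℝ≥0∞ := μ Set.univ ^ (1 / (p : ℝ≥0∞).toReal - 1 / (2 : ℝ≥0∞).toReal)
  have hM : M ≠ ⊤ := by
    refine ENNReal.rpow_ne_top_of_nonneg ?_ (measure_ne_top μ _)
    have hp2' : (p : ℝ) ≤ 2 := by exact_mod_cast hp2
    have hp1' : (1 : ℝ) ≤ p := by exact_mod_cast hp1
    have := one_div_le_one_div_of_le (by linarith) hp2'
    simpa using this
  refine ⟨M.toNNReal, fun g hg => ?_⟩
  rw [ENNReal.coe_toNNReal hM, mul_comm]
  exact eLpNorm_le_eLpNorm_mul_rpow_measure_univ (by exact_mod_cast hp2) hg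

theorem eLpNorm_six_test_le {p : ℝ≥0} (hp1 : 1 ≤ p) (hpd : p < Module.finrank ℝ (Space d))
    (hp6 : (p : ℝ)⁻¹ - (Module.finrank ℝ (Space d) : ℝ)⁻¹ ≤ ((6 : ℝ≥0) : ℝ)⁻¹)
    (hΩb : Bornology.IsBounded (Ω : Set (Space d))) (φ : 𝓓(Ω, ℝ)) :
    eLpNorm φ (6 : ℝ≥0) volume ≤
      eLpNormLESNormFDerivOfLeConst ℝ (volume : Measure (Space d)) (Ω : Set (Space d)) p 6 *
        eLpNorm (fderiv ℝ φ) p volume := by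
  have h1 : ContDiff ℝ 1 φ := φ.contDiff.of_le (by simp)
  have h2 : Function.support φ ⊆ (Ω : Set (Space d)) :=
    (subset_tsupport _).trans φ.tsupport_subset
  exact eLpNorm_le_eLpNorm_fderiv_of_le volume h1 h2 hp1 hpd hp6 hΩb

theorem eLpNorm_fderiv_test_restrict (φ : 𝓓(Ω, ℝ)) (p : ℝ≥0∞) :
    eLpNorm (fderiv ℝ φ) p (leb Ω) = eLpNorm (fderiv ℝ φ) p volume := by
  rw [← eLpNorm_norm, ← eLpNorm_norm (fderiv ℝ φ)]
  refine eLpNorm_restrict_eq_of_support_subset fun x hx => ?_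
  refine φ.tsupport_subset (support_fderiv_subset ℝ ?_)
  rw [Function.mem_support] at hx ⊢
  exact norm_ne_zero_iff.1 hx

theorem aestronglyMeasurable_fderiv_test (φ : 𝓓(Ω, ℝ)) :
    AEStronglyMeasurable (fderiv ℝ φ) (leb Ω) :=
  (φ.contDiff.continuous_fderiv (by simp)).aestronglyMeasurable

/-- The Sobolev inequality for test functions, in dimensions two and three. -/
theorem exists_eLpNorm_six_test_le (hd : d = 2 ∨ d = 3)
    (hΩb : Bornology.IsBounded (Ω : Set (Space d))) :
    ∃ C : ℝ≥0, ∀ φ : 𝓓(Ω, ℝ),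
      eLpNorm φ 6 (leb Ω) ≤ C * eLpNorm (fderiv ℝ φ) 2 (leb Ω) := by
  obtain ⟨p, hp1, hpd, hp6, hp2⟩ := exists_sobolev_exponent hd
  have : IsFiniteMeasure (leb Ω) := ⟨by simpa using hΩb.measure_lt_top⟩
  obtain ⟨M, hM⟩ := exists_eLpNorm_le_eLpNorm_two (F := Space d →L[ℝ] ℝ) (leb Ω) hp1 hp2
  refine ⟨eLpNormLESNormFDerivOfLeConst ℝ (volume : Measure (Space d)) (Ω : Set (Space d)) p 6 *
    M, fun φ => ?_⟩
  have h6 : eLpNorm φ 6 (leb Ω) ≤ eLpNorm φ (6 : ℝ≥0) volume := by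
    rw [ENNReal.coe_ofNat]
    exact eLpNorm_mono_measure _ Measure.restrict_le_self
  have h := h6.trans (eLpNorm_six_test_le hp1 hpd hp6 hΩb φ)
  rw [← eLpNorm_fderiv_test_restrict] at h
  rw [ENNReal.coe_mul, mul_assoc]
  exact h.trans (mul_le_mul_right (hM _ (aestronglyMeasurable_fderiv_test φ)) _)

theorem norm_fn_le (u : H10 Ω) : ‖fn u‖ ≤ ‖u‖ :=
  abs_le_of_sq_le_sq (by have := norm_sq_eq u; nlinarith [sq_nonneg ‖grad u‖]) (norm_nonneg u)
    |> (le_abs_self _).trans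

theorem eLpNorm_fderiv_test_le {u : H1 Ω} {φ : 𝓓(Ω, ℝ)} (hφ : u.1.fst =ᵐ[leb Ω] φ) :
    eLpNorm (fderiv ℝ φ) 2 (leb Ω) ≤ ENNReal.ofReal ‖u‖ := by
  have h1 : eLpNorm (fderiv ℝ φ) 2 (leb Ω) = ‖u.1.snd‖ₑ := by
    rw [Lp.enorm_def]
    exact eLpNorm_congr_norm_ae (IsWeakGradient.norm_ae_eq u.2 hφ)
  rw [h1, ← ofReal_norm]
  refine ENNReal.ofReal_le_ofReal (le_trans ?_ (Submodule.coe_norm u).ge)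
  have h2 := WithLp.prod_norm_sq_eq_of_L2 u.1
  exact abs_le_of_sq_le_sq' (by nlinarith [sq_nonneg ‖u.1.fst‖]) (norm_nonneg _) |>.2

/-- The Sobolev inequality on `H¹₀(Ω)`, in dimensions two and three. -/
theorem exists_eLpNorm_six_le (hd : d = 2 ∨ d = 3)
    (hΩb : Bornology.IsBounded (Ω : Set (Space d))) :
    ∃ C : ℝ≥0, ∀ u : H10 Ω, eLpNorm (fn u) 6 (leb Ω) ≤ C * ENNReal.ofReal ‖u‖ := by
  obtain ⟨C, hC⟩ := exists_eLpNorm_six_test_le hd hΩb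
  refine ⟨C, fun u => ?_⟩
  obtain ⟨w, hw, hlim⟩ := mem_closure_iff_seq_limit.1
    (show (u : H1 Ω) ∈ closure (testSubspace Ω : Set (H1 Ω)) from u.2)
  have hfst : Tendsto (fun n => (w n).1.fst) atTop (𝓝 (fn u)) := by
    have hc : Continuous fun p : H1 Ω => p.1.fst :=
      continuous_fst.comp ((WithLp.prod_continuous_ofLp 2 _ _).comp continuous_subtype_val)
    exact (hc.tendsto _).comp hlim
  -- L² convergence gives an a.e. convergent subsequence, and Fatou's lemma carries the L⁶ bound to
  -- the limit.
  obtain ⟨k, hk, hae⟩ := (tendstoInMeasure_of_tendsto_Lp hfst).exists_seq_tendsto_ae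
  have hbound : ∀ n, eLpNorm (w (k n)).1.fst 6 (leb Ω) ≤ C * ENNReal.ofReal ‖w (k n)‖ := by
    intro n
    obtain ⟨φ, hφ⟩ := hw (k n)
    rw [eLpNorm_congr_ae hφ]
    exact (hC φ).trans (by gcongr; exact eLpNorm_fderiv_test_le hφ)
  have hr : Tendsto (fun n => C * ENNReal.ofReal ‖w (k n)‖) atTop
      (𝓝 (C * ENNReal.ofReal ‖u‖)) :=
    ENNReal.Tendsto.const_mul
      (ENNReal.tendsto_ofReal ((hlim.comp hk.tendsto_atTop).norm)) (Or.inr ENNReal.coe_ne_top)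
  calc eLpNorm (fn u) 6 (leb Ω)
      ≤ liminf (fun n => eLpNorm (w (k n)).1.fst 6 (leb Ω)) atTop :=
        Lp.eLpNorm_lim_le_liminf_eLpNorm (fun n => Lp.aestronglyMeasurable _) _ hae
    _ ≤ liminf (fun n => C * ENNReal.ofReal ‖w (k n)‖) atTop :=
        liminf_le_liminf (Eventually.of_forall hbound)
    _ = C * ENNReal.ofReal ‖u‖ := hr.liminf_eq

noncomputable scoped instance : NormedAddCommGroup (H10 Ω) := Submodule.normedAddCommGroup (H10 Ω)

noncomputable scoped instance : NormedSpace ℝ (H10 Ω) := Submodule.normedSpace (H10 Ω)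

noncomputable scoped instance : InnerProductSpace ℝ (H10 Ω) := Submodule.innerProductSpace (H10 Ω)

/-! ### The cubic nonlinearity -/

/-- The inclusion of `H¹₀(Ω)` into `L²(Ω)`. -/
noncomputable def fnL (Ω : Opens (Space d)) : H10 Ω →L[ℝ] L2 Ω :=
  LinearMap.mkContinuous
    { toFun := fn
      map_add' := fun _ _ => rfl
      map_smul' := fun _ _ => rfl } 1 fun u => (norm_fn_le u).trans_eq (one_mul _).symm

theorem fn_sub_ae (u v : H10 Ω) : fn (u - v) =ᵐ[leb Ω] fun x => fn u x - fn v x :=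
  Lp.coeFn_sub (fn u) (fn v)

instance : ENNReal.HolderTriple 6 6 3 where
  inv_add_inv_eq_inv := by
    rw [← ENNReal.toReal_eq_toReal_iff' (by simp) (by simp), ENNReal.toReal_add (by simp) (by simp)]
    norm_num

instance : ENNReal.HolderTriple 6 3 2 where
  inv_add_inv_eq_inv := by
    rw [← ENNReal.toReal_eq_toReal_iff' (by simp) (by simp), ENNReal.toReal_add (by simp) (by simp)]
    norm_num

/-- Hölder's inequality for three factors in `L⁶`. -/
theorem eLpNorm_mul_mul_le {α : Type*} [MeasurableSpace α] {μ : Measure α} {a b c : α → ℝ}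
    (ha : AEStronglyMeasurable a μ) (hb : AEStronglyMeasurable b μ)
    (hc : AEStronglyMeasurable c μ) :
    eLpNorm (fun x => a x * (b x * c x)) 2 μ ≤
      eLpNorm a 6 μ * (eLpNorm b 6 μ * eLpNorm c 6 μ) := by
  have h1 : eLpNorm (b • c) 3 μ ≤ eLpNorm b 6 μ * eLpNorm c 6 μ :=
    eLpNorm_smul_le_mul_eLpNorm hc hb
  have h2 : eLpNorm (a • (b • c)) 2 μ ≤ eLpNorm a 6 μ * eLpNorm (b • c) 3 μ :=
    eLpNorm_smul_le_mul_eLpNorm (hb.smul hc) ha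
  exact h2.trans (by gcongr)

/-- `C` is a constant in the Sobolev inequality `‖u‖_{L⁶} ≤ C ‖u‖₁` on `H¹₀(Ω)`. -/
def IsSobolevConst (Ω : Opens (Space d)) (C : ℝ≥0) : Prop :=
  ∀ u : H10 Ω, eLpNorm (fn u) 6 (leb Ω) ≤ C * ENNReal.ofReal ‖u‖

theorem IsSobolevConst.eLpNorm_mul_mul_le {C : ℝ≥0} (hC : IsSobolevConst Ω C) (a b c : H10 Ω) :
    eLpNorm (fun x => fn a x * (fn b x * fn c x)) 2 (leb Ω) ≤
      ENNReal.ofReal (C ^ 3 * (‖a‖ * (‖b‖ * ‖c‖))) := by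
  have hR : ∀ u : H10 Ω, eLpNorm (fn u) 6 (leb Ω) ≤ ENNReal.ofReal (C * ‖u‖) := fun u => by
    rw [ENNReal.ofReal_mul C.coe_nonneg, ENNReal.ofReal_coe_nnreal]
    exact hC u
  calc eLpNorm (fun x => fn a x * (fn b x * fn c x)) 2 (leb Ω)
      ≤ eLpNorm (fn a) 6 (leb Ω) * (eLpNorm (fn b) 6 (leb Ω) * eLpNorm (fn c) 6 (leb Ω)) :=
        NonlinearFEM.eLpNorm_mul_mul_le (Lp.aestronglyMeasurable _) (Lp.aestronglyMeasurable _)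
          (Lp.aestronglyMeasurable _)
    _ ≤ ENNReal.ofReal (C * ‖a‖) * (ENNReal.ofReal (C * ‖b‖) * ENNReal.ofReal (C * ‖c‖)) := by
        gcongr <;> exact hR _
    _ = ENNReal.ofReal (C ^ 3 * (‖a‖ * (‖b‖ * ‖c‖))) := by
        rw [← ENNReal.ofReal_mul (by positivity), ← ENNReal.ofReal_mul (by positivity)]
        congr 1
        ring

theorem IsSobolevConst.memLp_mul_mul {C : ℝ≥0} (hC : IsSobolevConst Ω C) (a b c : H10 Ω) :
    MemLp (fun x => fn a x * (fn b x * fn c x)) 2 (leb Ω) :=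
  ⟨(Lp.aestronglyMeasurable (fn a)).mul
      ((Lp.aestronglyMeasurable (fn b)).mul (Lp.aestronglyMeasurable (fn c))),
    (hC.eLpNorm_mul_mul_le a b c).trans_lt ENNReal.ofReal_lt_top⟩

theorem IsSobolevConst.memLp_cube {C : ℝ≥0} (hC : IsSobolevConst Ω C) (w : H10 Ω) :
    MemLp (fun x => fn w x ^ 3) 2 (leb Ω) := by
  refine (memLp_congr_ae (Eventually.of_forall fun x => ?_)).1 (hC.memLp_mul_mul w w w)
  ring

/-- The cubic nonlinearity `w ↦ w³`, as a map from `H¹₀(Ω)` to `L²(Ω)`. -/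
noncomputable def cube {C : ℝ≥0} (hC : IsSobolevConst Ω C) (w : H10 Ω) : L2 Ω :=
  (hC.memLp_cube w).toLp _

theorem coeFn_cube {C : ℝ≥0} (hC : IsSobolevConst Ω C) (w : H10 Ω) :
    cube hC w =ᵐ[leb Ω] fun x => fn w x ^ 3 :=
  (hC.memLp_cube w).coeFn_toLp

/-- Factor `u³ - v³ = (u - v)(u² + uv + v²)` and apply Hölder and Sobolev to each of the three
triple products. -/
theorem norm_cube_sub_le {C : ℝ≥0} (hC : IsSobolevConst Ω C) (u v : H10 Ω) :
    ‖cube hC u - cube hC v‖ ≤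
      C ^ 3 * ((‖u‖ ^ 2 + ‖u‖ * ‖v‖ + ‖v‖ ^ 2) * ‖u - v‖) := by
  set T : H10 Ω → H10 Ω → L2 Ω := fun b c => (hC.memLp_mul_mul (u - v) b c).toLp _
  have hT : ∀ b c, ‖T b c‖ ≤ C ^ 3 * (‖u - v‖ * (‖b‖ * ‖c‖)) := fun b c => by
    rw [Lp.norm_toLp]
    exact ENNReal.toReal_le_of_le_ofReal (by positivity) (hC.eLpNorm_mul_mul_le _ b c)
  have h : cube hC u - cube hC v = T u u + T u v + T v v := by
    refine Lp.ext ?_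
    filter_upwards [Lp.coeFn_sub (cube hC u) (cube hC v), coeFn_cube hC u, coeFn_cube hC v,
      Lp.coeFn_add (T u u + T u v) (T v v), Lp.coeFn_add (T u u) (T u v), fn_sub_ae u v,
      (hC.memLp_mul_mul (u - v) u u).coeFn_toLp, (hC.memLp_mul_mul (u - v) u v).coeFn_toLp,
      (hC.memLp_mul_mul (u - v) v v).coeFn_toLp] with x h1 h2 h3 h4 h5 h6 h7 h8 h9
    simp only [Pi.add_apply, Pi.sub_apply] at h1 h4 h5
    rw [h1, h2, h3, h4, h5, h7, h8, h9, h6]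
    ring
  calc ‖cube hC u - cube hC v‖ ≤ ‖T u u‖ + ‖T u v‖ + ‖T v v‖ := by
        rw [h]; exact norm_add₃_le
    _ ≤ C ^ 3 * (‖u - v‖ * (‖u‖ * ‖u‖)) + C ^ 3 * (‖u - v‖ * (‖u‖ * ‖v‖)) +
          C ^ 3 * (‖u - v‖ * (‖v‖ * ‖v‖)) := by gcongr <;> exact hT _ _
    _ = C ^ 3 * ((‖u‖ ^ 2 + ‖u‖ * ‖v‖ + ‖v‖ ^ 2) * ‖u - v‖) := by ring

theorem continuous_cube {C : ℝ≥0} (hC : IsSobolevConst Ω C) : Continuous (cube hC) := by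
  refine continuous_iff_continuousAt.2 fun v => tendsto_iff_norm_sub_tendsto_zero.2 ?_
  refine squeeze_zero (fun _ => norm_nonneg _) (fun u => norm_cube_sub_le hC u v) ?_
  have hc : Continuous fun u : H10 Ω =>
      (C : ℝ) ^ 3 * ((‖u‖ ^ 2 + ‖u‖ * ‖v‖ + ‖v‖ ^ 2) * ‖u - v‖) := by fun_prop
  simpa using hc.tendsto v

/-! ### The energy and its derivative -/

/-- The derivative of the energy at `u`: the functional `v ↦ a_nl(u, v) - (f, v)`. -/
noncomputable def residual {C : ℝ≥0} (hC : IsSobolevConst Ω C) (f : L2 Ω) (u : H10 Ω) :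
    H10 Ω →L[ℝ] ℝ :=
  innerSL ℝ u + (innerSL ℝ (cube hC u - f)).comp (fnL Ω)

theorem residual_apply {C : ℝ≥0} (hC : IsSobolevConst Ω C) (f : L2 Ω) (u v : H10 Ω) :
    residual hC f u v = inner ℝ u v + (inner ℝ (cube hC u) (fn v) - inner ℝ f (fn v)) := by
  rw [← inner_sub_left]
  rfl

theorem continuous_residual {C : ℝ≥0} (hC : IsSobolevConst Ω C) (f : L2 Ω) (v : H10 Ω) :
    Continuous fun u => residual hC f u v := by
  simp only [residual_apply]
  have h1 : Continuous fun u : H10 Ω => inner ℝ u v := continuous_id.inner continuous_const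
  exact h1.add (((continuous_cube hC).inner continuous_const).sub continuous_const)

theorem load_eq_inner (f : L2 Ω) (v : H10 Ω) : load f v = inner ℝ f (fn v) := by
  rw [L2.inner_def]
  exact integral_congr_ae (Eventually.of_forall fun x => mul_comm _ _)

theorem inner_cube_eq {C : ℝ≥0} (hC : IsSobolevConst Ω C) (u v : H10 Ω) :
    inner ℝ (cube hC u) (fn v) = ∫ x, fn u x ^ 3 * fn v x ∂(leb Ω) := by
  rw [L2.inner_def]
  refine integral_congr_ae ?_
  filter_upwards [coeFn_cube hC u] with x hx
  rw [hx]
  exact mul_comm _ _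

theorem inner_eq_integral (u v : H10 Ω) :
    inner ℝ u v = (∫ x, inner ℝ (grad u x) (grad v x) ∂(leb Ω)) +
      ∫ x, fn u x * fn v x ∂(leb Ω) := by
  have h : inner ℝ u v = inner ℝ (fn u) (fn v) + inner ℝ (grad u) (grad v) :=
    WithLp.prod_inner_apply u.1.1 v.1.1
  rw [h, add_comm, L2.inner_def, L2.inner_def]
  congr 1
  exact integral_congr_ae (Eventually.of_forall fun x => mul_comm _ _)

theorem residual_eq {C : ℝ≥0} (hC : IsSobolevConst Ω C) (f : L2 Ω) (u v : H10 Ω) :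
    residual hC f u v = aNl u v - load f v := by
  rw [residual_apply, inner_eq_integral, inner_cube_eq, load_eq_inner, aNl]
  ring

/-- The energy whose critical points are the weak solutions. -/
noncomputable def energy (f : L2 Ω) (u : H10 Ω) : ℝ :=
  ‖u‖ ^ 2 / 2 + (∫ x, fn u x ^ 4 ∂(leb Ω)) / 4 - load f u

/-- The quadratic part expands exactly, with remainder `‖v - u‖²/2`; the load is linear; the quartic
part is convex pointwise. -/
theorem energy_strongly_convex {C : ℝ≥0} (hC : IsSobolevConst Ω C) (f : L2 Ω) (u v : H10 Ω) :
    energy f u + residual hC f u (v - u) + ‖v - u‖ ^ 2 / 2 ≤ energy f v := by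
  have hint4 : ∀ w : H10 Ω, Integrable (fun x => fn w x ^ 4) (leb Ω) := fun w =>
    ((hC.memLp_cube w).integrable_mul (Lp.memLp (fn w))).congr
      (Eventually.of_forall fun x => (pow_succ (fn w x) 3).symm)
  have hint : Integrable (fun x => fn u x ^ 3 * fn (v - u) x) (leb Ω) :=
    (hC.memLp_cube u).integrable_mul (Lp.memLp (fn (v - u)))
  have hquartic : (∫ x, fn u x ^ 4 ∂(leb Ω)) / 4 + ∫ x, fn u x ^ 3 * fn (v - u) x ∂(leb Ω) ≤
      (∫ x, fn v x ^ 4 ∂(leb Ω)) / 4 := by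
    rw [← integral_div, ← integral_div, ← integral_add ((hint4 u).div_const 4) hint]
    refine integral_mono_ae (((hint4 u).div_const 4).add hint) ((hint4 v).div_const 4) ?_
    filter_upwards [fn_sub_ae v u] with x hx
    rw [hx]
    -- With `a = fn u x` and `b = fn v x`: `b⁴ - a⁴ - 4a³(b - a) = (b - a)²((b + a)² + 2a²)`.
    nlinarith [mul_nonneg (sq_nonneg (fn v x - fn u x))
      (add_nonneg (sq_nonneg (fn v x + fn u x)) (sq_nonneg (fn u x)))]
  have hload : load f (v - u) = load f v - load f u := by
    simp only [load_eq_inner]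
    exact inner_sub_right _ _ _
  have hnorm : ‖v‖ ^ 2 = ‖u‖ ^ 2 + 2 * inner ℝ u (v - u) + ‖v - u‖ ^ 2 := by
    have h1 := norm_add_sq_real u (v - u)
    have h2 : u + (v - u) = v := add_sub_cancel u v
    exact (congrArg (fun w : H10 Ω => ‖w‖ ^ 2) h2).symm.trans h1
  rw [residual_apply, inner_cube_eq, ← load_eq_inner, hload, energy, energy, hnorm]
  linarith

theorem abs_residual_sub_le {C : ℝ≥0} (hC : IsSobolevConst Ω C) (f : L2 Ω) (u v w : H10 Ω) :
    |residual hC f u w - residual hC f v w| ≤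
      (1 + C ^ 3 * (‖u‖ ^ 2 + ‖u‖ * ‖v‖ + ‖v‖ ^ 2)) * ‖u - v‖ * ‖w‖ := by
  have h : residual hC f u w - residual hC f v w =
      inner ℝ (u - v) w + inner ℝ (cube hC u - cube hC v) (fn w) := by
    have h1 : inner ℝ (u - v) w = inner ℝ u w - inner ℝ v w := inner_sub_left u v w
    rw [residual_apply, residual_apply, h1, inner_sub_left]
    ring
  calc |residual hC f u w - residual hC f v w|
      ≤ ‖u - v‖ * ‖w‖ + ‖cube hC u - cube hC v‖ * ‖fn w‖ := by
        rw [h]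
        exact (abs_add_le _ _).trans
          (add_le_add (abs_real_inner_le_norm _ _) (abs_real_inner_le_norm _ _))
    _ ≤ ‖u - v‖ * ‖w‖ +
          C ^ 3 * ((‖u‖ ^ 2 + ‖u‖ * ‖v‖ + ‖v‖ ^ 2) * ‖u - v‖) * ‖w‖ := by
        gcongr
        · exact norm_cube_sub_le hC u v
        · exact norm_fn_le w
    _ = _ := by ring

theorem abs_residual_zero_le {C : ℝ≥0} (hC : IsSobolevConst Ω C) (f : L2 Ω) (v : H10 Ω) :
    |residual hC f 0 v| ≤ ‖f‖ * ‖v‖ := by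
  have hz : ∀ᵐ x ∂(leb Ω), fn (0 : H10 Ω) x = 0 := Lp.coeFn_zero ℝ 2 (leb Ω)
  have hc : ∫ x, fn (0 : H10 Ω) x ^ 3 * fn v x ∂(leb Ω) = 0 :=
    integral_eq_zero_of_ae (by filter_upwards [hz] with x hx; simp [hx])
  have h0 : inner ℝ (0 : H10 Ω) v = 0 := inner_zero_left v
  rw [residual_apply, inner_cube_eq, hc, h0, zero_add, zero_sub, abs_neg]
  exact (abs_real_inner_le_norm _ _).trans (by gcongr; exact norm_fn_le v)

/-! ### Closedness of the finite element space -/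

/-- The class in `L²` of the affine function `x ↦ L x + c`. -/
noncomputable def affineLp (μ : Measure (Space d))
    (h : ∀ q : (Space d →L[ℝ] ℝ) × ℝ, MemLp (fun x => q.1 x + q.2) 2 μ) :
    ((Space d →L[ℝ] ℝ) × ℝ) →ₗ[ℝ] Lp ℝ 2 μ where
  toFun q := (h q).toLp _
  map_add' p q := by
    rw [← MemLp.toLp_add]
    refine MemLp.toLp_congr _ _ (Eventually.of_forall fun x => ?_)
    simp only [Prod.fst_add, Prod.snd_add, add_apply, Pi.add_apply]
    ring
  map_smul' c q := by
    rw [RingHom.id_apply, ← MemLp.toLp_const_smul]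
    refine MemLp.toLp_congr _ _ (Eventually.of_forall fun x => ?_)
    simp only [Prod.smul_fst, Prod.smul_snd, smul_apply, Pi.smul_apply,
      smul_eq_mul]
    ring

theorem memLp_affine_of_isCompact {T : Set (Space d)} (hT : IsCompact T)
    (q : (Space d →L[ℝ] ℝ) × ℝ) :
    MemLp (fun x => q.1 x + q.2) 2 ((leb Ω).restrict T) := by
  have hc : Continuous fun x => q.1 x + q.2 := by fun_prop
  obtain ⟨M, hM⟩ := hT.exists_bound_of_continuousOn hc.continuousOn
  have : IsFiniteMeasure ((leb Ω).restrict T) :=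
    ⟨by simpa using hT.measure_lt_top (μ := leb Ω)⟩
  refine MemLp.of_bound hc.aestronglyMeasurable M ?_
  exact (ae_restrict_iff' hT.measurableSet).2 (Eventually.of_forall hM)

theorem exists_affine_iff {T : Set (Space d)} (hT : IsCompact T) (v : H10 Ω) :
    (∃ p : Space d →ᵃ[ℝ] ℝ, ∀ᵐ x ∂(leb Ω), x ∈ T → fn v x = p x) ↔
      LpToLpRestrictCLM (Space d) ℝ ℝ (leb Ω) 2 T (fn v) ∈
        LinearMap.range (affineLp _ (memLp_affine_of_isCompact (Ω := Ω) hT)) := by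
  have hres := LpToLpRestrictCLM_coeFn ℝ T (fn v)
  constructor
  · rintro ⟨p, hp⟩
    refine ⟨(LinearMap.toContinuousLinearMap p.linear, p 0), Lp.ext ?_⟩
    rw [← ae_restrict_iff' hT.measurableSet] at hp
    filter_upwards [hp, hres, (memLp_affine_of_isCompact (Ω := Ω) hT
      (LinearMap.toContinuousLinearMap p.linear, p 0)).coeFn_toLp] with x h1 h2 h3
    rw [h2, h1]
    refine h3.trans ?_
    have h4 := p.map_vadd 0 x
    simpa using h4.symm
  · rintro ⟨q, hq⟩
    refine ⟨(q.1 : Space d →ₗ[ℝ] ℝ).toAffineMap + AffineMap.const ℝ (Space d) q.2, ?_⟩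
    rw [← ae_restrict_iff' hT.measurableSet]
    filter_upwards [hres, (memLp_affine_of_isCompact (Ω := Ω) hT q).coeFn_toLp] with x h1 h2
    rw [← h1, ← hq]
    exact h2

theorem Triangulation.IsElement.isCompact {𝒯 : Triangulation Ω} {T : Set (Space d)}
    (hT : 𝒯.IsElement T) : IsCompact T := by
  obtain ⟨s, -, -, rfl⟩ := hT
  exact s.finite_toSet.isCompact_convexHull ℝ

/-- On each element the condition is that the restriction lies in the image of the affine functions,
a finite-dimensional and hence closed subspace of L²; restriction is continuous. -/
theorem Triangulation.isClosed_feSpace (𝒯 : Triangulation Ω) :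
    IsClosed (𝒯.feSpace : Set (H10 Ω)) := by
  have h : (𝒯.feSpace : Set (H10 Ω)) =
      ⋂ (T : Set (Space d)) (hT : 𝒯.IsElement T),
        (fun v => LpToLpRestrictCLM (Space d) ℝ ℝ (leb Ω) 2 T (fnL Ω v)) ⁻¹'
          (LinearMap.range (affineLp _ (memLp_affine_of_isCompact (Ω := Ω) hT.isCompact)) :
            Set (Lp ℝ 2 ((leb Ω).restrict T))) := by
    ext v
    simp only [Set.mem_iInter]
    exact forall_congr' fun T => forall_congr' fun hT => exists_affine_iff hT.isCompact v
  rw [h]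
  refine isClosed_iInter fun T => isClosed_iInter fun hT => IsClosed.preimage ?_ ?_
  · exact (LpToLpRestrictCLM (Space d) ℝ ℝ (leb Ω) 2 T).continuous.comp (fnL Ω).continuous
  · exact Submodule.closed_of_finiteDimensional (𝕜 := ℝ)
      (LinearMap.range (affineLp _ (memLp_affine_of_isCompact (Ω := Ω) hT.isCompact)))

/-! ### Solvability, stability and quasi-optimality -/

theorem isWeakSolution_iff {C : ℝ≥0} (hC : IsSobolevConst Ω C) (f : L2 Ω) (u : H10 Ω) :
    IsWeakSolution f u ↔ IsGalerkinSolution (residual hC f) ⊤ u := by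
  refine ⟨fun h => ⟨Submodule.mem_top, fun v _ => ?_⟩, fun h v => ?_⟩
  · rw [residual_eq, h v, sub_self]
  · exact sub_eq_zero.1 ((residual_eq hC f u v).symm.trans (h.2 v Submodule.mem_top))

theorem isDiscreteSolution_iff {C : ℝ≥0} (hC : IsSobolevConst Ω C) (f : L2 Ω)
    (𝒯 : Triangulation Ω) (uh : 𝒯.feSpace) :
    IsDiscreteSolution f 𝒯 uh ↔ IsGalerkinSolution (residual hC f) 𝒯.feSpace uh := by
  refine ⟨fun h => ⟨uh.2, fun v hv => ?_⟩, fun h v => ?_⟩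
  · rw [residual_eq, sub_eq_zero]
    exact h ⟨v, hv⟩
  · exact sub_eq_zero.1 ((residual_eq hC f uh v).symm.trans (h.2 v v.2))

theorem IsGalerkinSolution.norm_le_load {C : ℝ≥0} (hC : IsSobolevConst Ω C) {f : L2 Ω}
    {V : Submodule ℝ (H10 Ω)} {u : H10 Ω} (hu : IsGalerkinSolution (residual hC f) V u) :
    ‖u‖ ≤ ‖f‖ :=
  hu.norm_le (energy_strongly_convex hC f) (norm_nonneg f) (abs_residual_zero_le hC f)

/-- Applied with `R = ‖f‖`, the stability radius, which makes the Lipschitz constant independent of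
the mesh. -/
theorem residual_lipschitz_on_ball {C : ℝ≥0} (hC : IsSobolevConst Ω C) (f : L2 Ω)
    {R : ℝ} (u v w : H10 Ω) (hu : ‖u‖ ≤ R) (hv : ‖v‖ ≤ R) :
    |residual hC f u w - residual hC f v w| ≤
      (1 + 3 * C ^ 3 * R ^ 2) * ‖u - v‖ * ‖w‖ := by
  refine (abs_residual_sub_le hC f u v w).trans ?_
  have hR : 0 ≤ R := (norm_nonneg u).trans hu
  have h : (C : ℝ) ^ 3 * (‖u‖ ^ 2 + ‖u‖ * ‖v‖ + ‖v‖ ^ 2) ≤ C ^ 3 * (R ^ 2 + R * R + R ^ 2) := by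
    gcongr
  have h' : 1 + (C : ℝ) ^ 3 * (‖u‖ ^ 2 + ‖u‖ * ‖v‖ + ‖v‖ ^ 2) ≤ 1 + 3 * C ^ 3 * R ^ 2 := by
    linarith
  exact mul_le_mul_of_nonneg_right (mul_le_mul_of_nonneg_right h' (norm_nonneg _))
    (norm_nonneg _)

theorem existsUnique_isWeakSolution {C : ℝ≥0} (hC : IsSobolevConst Ω C) (f : L2 Ω) :
    ∃! u : H10 Ω, IsWeakSolution f u := by
  have hconv := energy_strongly_convex hC f
  obtain ⟨u, hu⟩ := exists_isGalerkinSolution (continuous_residual hC f) hconv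
    (V := (⊤ : Submodule ℝ (H10 Ω))) isClosed_univ
  exact ⟨u, (isWeakSolution_iff hC f u).2 hu, fun v hv =>
    ((isWeakSolution_iff hC f v).1 hv).unique hconv hu⟩

theorem existsUnique_isDiscreteSolution {C : ℝ≥0} (hC : IsSobolevConst Ω C) (f : L2 Ω)
    (𝒯 : Triangulation Ω) : ∃! uh : 𝒯.feSpace, IsDiscreteSolution f 𝒯 uh := by
  have hconv := energy_strongly_convex hC f
  obtain ⟨u, hu⟩ := exists_isGalerkinSolution (continuous_residual hC f) hconv 𝒯.isClosed_feSpace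
  exact ⟨⟨u, hu.1⟩, (isDiscreteSolution_iff hC f 𝒯 ⟨u, hu.1⟩).2 hu, fun v hv =>
    Subtype.ext (((isDiscreteSolution_iff hC f 𝒯 v).1 hv).unique hconv hu)⟩

/-- Quasi-optimality of the finite element solution, with an explicit constant. -/
theorem IsWeakSolution.norm_sub_discrete_le {C : ℝ≥0} (hC : IsSobolevConst Ω C) {f : L2 Ω}
    {u : H10 Ω} (hu : IsWeakSolution f u) {𝒯 : Triangulation Ω} {uh : 𝒯.feSpace}
    (huh : IsDiscreteSolution f 𝒯 uh) (v : 𝒯.feSpace) :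
    ‖u - uh‖ ≤ (1 + 3 * C ^ 3 * ‖f‖ ^ 2) * ‖u - v‖ := by
  replace hu := (isWeakSolution_iff hC f u).1 hu
  replace huh := (isDiscreteSolution_iff hC f 𝒯 uh).1 huh
  exact hu.norm_sub_le (energy_strongly_convex hC f) (by positivity)
    (residual_lipschitz_on_ball hC f) huh (hu.norm_le_load hC) (huh.norm_le_load hC) v.2

end NonlinearFEM

theorem mainTheorem6 {d : ℕ} (hd : d = 2 ∨ d = 3)
    (Ω : TopologicalSpace.Opens (NonlinearFEM.Space d))
    (hΩc : IsConnected (Ω : Set (NonlinearFEM.Space d)))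
    (hΩb : Bornology.IsBounded (Ω : Set (NonlinearFEM.Space d)))
    (f : NonlinearFEM.L2 Ω) :
    -- the cubic term of the form is well defined
    (∀ w : NonlinearFEM.H10 Ω,
      MeasureTheory.MemLp (fun x => NonlinearFEM.fn w x ^ 3) 2 (NonlinearFEM.leb Ω)) ∧
    -- unique solvability of the weak problem and of every discrete problem
    (∃! u : NonlinearFEM.H10 Ω, NonlinearFEM.IsWeakSolution f u) ∧
    (∀ 𝒯 : NonlinearFEM.Triangulation Ω,
      ∃! uh : 𝒯.feSpace, NonlinearFEM.IsDiscreteSolution f 𝒯 uh) ∧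
    -- stability
    (∀ u : NonlinearFEM.H10 Ω, NonlinearFEM.IsWeakSolution f u → ‖u‖ ≤ ‖f‖) ∧
    (∀ (𝒯 : NonlinearFEM.Triangulation Ω) (uh : 𝒯.feSpace),
      NonlinearFEM.IsDiscreteSolution f 𝒯 uh → ‖uh‖ ≤ ‖f‖) ∧
    -- a priori error estimate, with a constant that does not depend on the mesh
    (∃ c : ℝ, 0 < c ∧
      ∀ u : NonlinearFEM.H10 Ω, NonlinearFEM.IsWeakSolution f u →
      ∀ (𝒯 : NonlinearFEM.Triangulation Ω) (uh : 𝒯.feSpace),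
        NonlinearFEM.IsDiscreteSolution f 𝒯 uh →
          ‖u - uh‖ ≤ c * ⨅ v : 𝒯.feSpace, ‖u - v‖) := by
  obtain ⟨C, hC⟩ := NonlinearFEM.exists_eLpNorm_six_le hd hΩb
  replace hC : NonlinearFEM.IsSobolevConst Ω C := hC
  refine ⟨hC.memLp_cube, NonlinearFEM.existsUnique_isWeakSolution hC f,
    NonlinearFEM.existsUnique_isDiscreteSolution hC f, fun u hu => ?_, fun 𝒯 uh huh => ?_,
    1 + 3 * C ^ 3 * ‖f‖ ^ 2, by positivity, fun u hu 𝒯 uh huh => ?_⟩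
  · exact ((NonlinearFEM.isWeakSolution_iff hC f u).1 hu).norm_le_load hC
  · exact ((NonlinearFEM.isDiscreteSolution_iff hC f 𝒯 uh).1 huh).norm_le_load hC
  · rw [Real.mul_iInf_of_nonneg (by positivity)]
    exact le_ciInf fun v => hu.norm_sub_discrete_le hC huh v
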